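/- Let $J,K$ be natural numbers, let $Q=(q_{jk})$ be a $J\times K$ binary matrix with rows $\mathbf q_1,\dots,\mathbf q_J$, and for $\alpha,\beta\in\{0,1\}^K$ write $\alpha\succeq\beta$ if $\alpha_k\ge\beta_k$ for all $k$. Let $\mathbf e_k$ be the $k$-th standard basis vector of $\{0,1\}^K$, and let $\mathbf 0$ and $\mathbf 1$ be the all-zero and the all-one vector. The parameters of the $Q$-restricted latent class model are the pairs $(\Theta,\mathbf p)$ with $\Theta=(\theta_{j,\alpha})\in[0,1]^{J\times\{0,1\}^K}$ and $\mathbf p=(p_\alpha)_{\alpha\in\{0,1\}^K}$, $p_\alpha\in(0,1)$, $\sum_\alpha p_\alpha=1$, such that \[ \max_{\alpha\succeq\mathbf q_j}\theta_{j,\alpha}=\min_{\alpha\succeq\mathbf q_j}\theta_{j,\alpha}\ \ge\ \theta_{j,\alpha'}\ \ge\ \theta_{j,\mathbf 0}\qquad\text{for all } j \text{ and all } \alpha'\in\{0,1\}^K, \] and \[ \theta_{j,\mathbf 1}>\max_{\alpha\not\succeq\mathbf e_k}\theta_{j,\alpha}\qquad\text{for all } k \text{ and all } j \text{ with } \mathbf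 q_j=\mathbf e_k . \] The distribution of the binary response vector $\mathbf R\in\{0,1\}^J$ under $(\Theta,\mathbf p)$ is \[ P(\mathbf R=\mathbf r\mid\Theta,\mathbf p)=\sum_{\alpha\in\{0,1\}^K}p_\alpha\prod_{j=1}^J\theta_{j,\alpha}^{r_j}(1-\theta_{j,\alpha})^{1-r_j}. \] Theorem. Let $(\Theta,\mathbf p)$ be parameters of the $Q$-restricted latent class model. Suppose that (C1) after a reordering of its rows, $Q$ consists of two copies of the $K\times K$ identity matrix (rows $1,\dots,2K$) followed by a matrix $Q'$ (rows $j>2K$); (C2) for every $k\in\{1,\dots,K\}$ there is an item $j>2K$ (an item of $Q'$) with $\theta_{j,\mathbf e_k}\ne\theta_{j,\mathbf 0}$. Then $(\Theta,\mathbf p)$ is identifiable: for all parameters $(\bar\Theta,\bar{\mathbf p})$ of the $Q$-restricted latent class model, $P(\mathbf R=\mathbf r\mid\Theta,\mathbf p)=P(\mathbf R=\mathbf r\mid\bar\Theta,\bar{\mathbf p})$ holds for all $\mathbf r\in\{0,1\}^J$ if and only if $(\Theta,\mathbf p)=(\bar\Theta,\bar{\mathbf p})$. In particular, no relabelling of the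 latent classes is needed. -/

import Mathlib

namespace RestrictedLCM

/-- Attribute profiles (latent classes) `α ∈ {0,1}^K`. The order on them is the coordinatewise
one, so `q ≤ α` says that `α` possesses every attribute that `q` requires. -/
abbrev Profile (K : ℕ) : Type := Fin K → Fin 2

/-- Response vectors `r ∈ {0,1}^J`. -/
abbrev Response (J : ℕ) : Type := Fin J → Fin 2

/-- `Q`-matrices: `J × K` binary matrices; the row `Q j` lists the attributes linked to item `j`. -/
abbrev QMatrix (J K : ℕ) : Type := Matrix (Fin J) (Fin K) (Fin 2)

/-- The item parameters `Θ = (θ_{j,α})`, a `J × 2^K` real matrix. -/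
abbrev ItemParam (J K : ℕ) : Type := Matrix (Fin J) (Profile K) ℝ

/-- The profile `e_k` that has the attribute `k` and no other. -/
def unitProfile {K : ℕ} (k : Fin K) : Profile K := Pi.single k 1

/-- `Θ` consists of probabilities and satisfies the monotonicity relations attached to `Q`. -/
structure IsItemParam {J K : ℕ} (Q : QMatrix J K) (Θ : ItemParam J K) : Prop where
  /-- every entry is a probability -/
  mem_unit : ∀ j α, Θ j α ∈ Set.Icc (0 : ℝ) 1
  /-- `max_{α ⪰ q_j} θ_{j,α} = min_{α ⪰ q_j} θ_{j,α}` -/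
  capable_eq : ∀ j α β, Q j ≤ α → Q j ≤ β → Θ j α = Θ j β
  /-- the common value on `{α ⪰ q_j}` is at least `θ_{j,α'}` for every `α'` -/
  le_capable : ∀ j α α', Q j ≤ α → Θ j α' ≤ Θ j α
  /-- `θ_{j,α'} ≥ θ_{j,0}` for every `α'` -/
  zero_le : ∀ j α', Θ j 0 ≤ Θ j α'
  /-- if `q_j = e_k` then `θ_{j,1} > max_{α ⋡ e_k} θ_{j,α}` -/
  strict : ∀ j k, Q j = unitProfile k → ∀ α, ¬ unitProfile k ≤ α → Θ j α < Θ j 1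

/-- `p` is a vector of latent class proportions: `p_α ∈ (0,1)` and `∑_α p_α = 1`. -/
structure IsProportion {K : ℕ} (p : Profile K → ℝ) : Prop where
  mem_Ioo : ∀ α, p α ∈ Set.Ioo (0 : ℝ) 1
  sum_eq_one : ∑ α, p α = 1

/-- `P(R = r ∣ α)`: given the profile, the responses are independent Bernoulli variables with
success probabilities `θ_{j,α}`. -/
def condProb {J K : ℕ} (Θ : ItemParam J K) (r : Response J) (α : Profile K) : ℝ :=
  ∏ j, if r j = 1 then Θ j α else 1 - Θ j α

/-- `P(R = r ∣ Θ, p)`, the distribution of the response vector. -/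
def responseProb {J K : ℕ} (Θ : ItemParam J K) (p : Profile K → ℝ) (r : Response J) : ℝ :=
  ∑ α, condProb Θ r α * p α

/-- `(Θ, p)` is (strictly) identifiable: among all the admissible parameters of the model with the
matrix `Q`, only `(Θ, p)` itself has the response distribution of `(Θ, p)`. -/
def Identifiable {J K : ℕ} (Q : QMatrix J K) (Θ : ItemParam J K) (p : Profile K → ℝ) : Prop :=
  ∀ (Θ' : ItemParam J K) (p' : Profile K → ℝ), IsItemParam Q Θ' → IsProportion p' →
    ((∀ r, responseProb Θ p r = responseProb Θ' p' r) ↔ (Θ = Θ' ∧ p = p'))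

/-- After a reordering of the rows, `Q` consists of two copies of the `K × K` identity matrix and a
further matrix `Q'`: the `k`-th row of the first copy is the row `rows (inl k)` of `Q`, that of the
second copy is the row `rows (inr k)`, and these `2K` rows are distinct. -/
def HasTwoIdentities {J K : ℕ} (Q : QMatrix J K) (rows : Fin K ⊕ Fin K ↪ Fin J) : Prop :=
  ∀ k, Q (rows (Sum.inl k)) = unitProfile k ∧ Q (rows (Sum.inr k)) = unitProfile k

/-- For every attribute `k`, some item outside the two identity blocks (that is, an item of `Q'`)
has different positive response probabilities at `e_k` and at `0`. -/
def Separates {J K : ℕ} (Θ : ItemParam J K) (rows : Fin K ⊕ Fin K ↪ Fin J) : Prop :=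
  ∀ k, ∃ j, j ∉ Set.range rows ∧ Θ j (unitProfile k) ≠ Θ j 0

end RestrictedLCM

/-! In each of the two models, the response distribution determines the sums
`∑ α, (∏ j ∈ S, (θ_{j,α} - σ_j)) p_α`, so one may choose the shifts `σ_j`. Shifting an item with
`q_j = e_k` by its value at `𝟏` kills all profiles that possess `k`. Shifting the first identity
block by its tops in one model and the second block by its tops in the other model leaves only the
profile `𝟎` in both sums, which identifies the item parameters of `Q'` at `𝟎`. If the second item
for attribute `k` is dropped and the first one is shifted by its top in the second model instead,
then the second sum still retains `𝟎` only, whereas the first one retains `𝟎` and `e_k`; an item of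
`Q'` separating `e_k` from `𝟎` shows that the term of `e_k` vanishes after all. The dropped item,
being free to multiply both sums, is thereby identified at `𝟎`. Shifting the first block by its tops
in the first model again, one sees that the second sum also retains `𝟎` only, which identifies the
tops. All parameters then follow by induction along the order on profiles. -/

open Finset

namespace RestrictedLCM

section Sums

variable {ι R : Type*} [Fintype ι] [Ring R] [NoZeroDivisors R] {w w' f f' : ι → R} {a b : ι}

theorem eq_of_sum_mul_eq_sum_mul (ha : w a ≠ 0) (hw : ∀ i ≠ a, w i = w' i)
    (hf : ∀ i ≠ a, w i = 0 ∨ f i = f' i) (hsum : ∑ i, w i = ∑ i, w' i)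
    (hsum_mul : ∑ i, (w * f) i = ∑ i, (w' * f') i) : f a = f' a := by
  have hwa : w a = w' a := (sum_eq_sum_iff_single (mem_univ a) fun i _ => hw i).1 hsum
  have hwf : ∀ i ≠ a, (w * f) i = (w' * f') i := fun i hi => by
    rcases hf i hi with h | h <;> simp [← hw i hi, h]
  have hwfa : w a * f a = w' a * f' a :=
    (sum_eq_sum_iff_single (mem_univ a) fun i _ => hwf i).1 hsum_mul
  exact mul_left_cancel₀ ha (by rw [hwfa, hwa])

theorem eq_zero_of_sum_mul_eq_sum_mul (hw : ∀ i, i ≠ a → i ≠ b → w i = 0)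
    (hw' : ∀ i ≠ a, w' i = 0) (hfa : f a = f' a) (hfb : f b ≠ f a)
    (hsum : ∑ i, w i = ∑ i, w' i) (hsum_mul : ∑ i, (w * f) i = ∑ i, (w' * f') i) : w b = 0 := by
  have hwb : w b * (f b - f a) = 0 := calc
    w b * (f b - f a) = ∑ i, w i * (f i - f a) := by
      symm
      refine Fintype.sum_eq_single b fun i hib => ?_
      rcases eq_or_ne i a with rfl | hia
      · rw [sub_self, mul_zero]
      · rw [hw i hia hib, zero_mul]
    _ = ∑ i, w' i * (f' i - f a) := by
      simp only [Pi.mul_apply] at hsum_mul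
      simp only [mul_sub, sum_sub_distrib, ← sum_mul, hsum, hsum_mul]
    _ = 0 := by
      refine sum_eq_zero fun i _ => ?_
      rcases eq_or_ne i a with rfl | hia
      · rw [hfa, sub_self, mul_zero]
      · rw [hw' i hia, zero_mul]
  exact (mul_eq_zero.1 hwb).resolve_right (sub_ne_zero.2 hfb)

end Sums

section Moments

variable {ι κ Ω : Type*}

/-- The weight `w` multiplied by the shifted variables `x i - σ i`, `i ∈ S`; its total mass is a
mixed moment of the variables `x i` under `w`. -/
def shiftedWeight (x : ι → Ω → ℝ) (S : Finset ι) (σ : ι → ℝ) (w : Ω → ℝ) : Ω → ℝ :=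
  fun ω => (∏ i ∈ S, (x i ω - σ i)) * w ω

/-- The families `x` and `x'` of variables have the same shifted square-free mixed moments under
the respective weights `w` and `w'`. Only square-free products are available because a response is
binary and an item is answered once. -/
def SameMoments [Fintype Ω] (x x' : ι → Ω → ℝ) (w w' : Ω → ℝ) : Prop :=
  ∀ (S : Finset ι) (σ : ι → ℝ), ∑ ω, shiftedWeight x S σ w ω = ∑ ω, shiftedWeight x' S σ w' ω

variable {x x' : ι → Ω → ℝ} {S : Finset ι} {σ : ι → ℝ} {w w' : Ω → ℝ} {ω : Ω}

theorem shiftedWeight_eq_zero_iff :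
    shiftedWeight x S σ w ω = 0 ↔ (∃ i ∈ S, x i ω = σ i) ∨ w ω = 0 := by
  simp only [shiftedWeight, mul_eq_zero, prod_eq_zero_iff, sub_eq_zero]

theorem shiftedWeight_ne_zero_iff :
    shiftedWeight x S σ w ω ≠ 0 ↔ (∀ i ∈ S, x i ω ≠ σ i) ∧ w ω ≠ 0 := by
  simp only [ne_eq, shiftedWeight_eq_zero_iff, not_or, not_exists, not_and]

theorem shiftedWeight_mul (f : Ω → ℝ) :
    shiftedWeight x S σ (w * f) = shiftedWeight x S σ w * f :=
  funext fun _ => (mul_assoc _ _ _).symm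

theorem shiftedWeight_insert [DecidableEq ι] {i : ι} (hi : i ∉ S) :
    shiftedWeight x (insert i S) (Function.update σ i 0) w = shiftedWeight x S σ w * x i := by
  funext ω
  have hS : ∏ l ∈ S, (x l ω - Function.update σ i 0 l) = ∏ l ∈ S, (x l ω - σ l) :=
    prod_congr rfl fun l hl => by rw [Function.update_of_ne (ne_of_mem_of_not_mem hl hi)]
  simp only [shiftedWeight, Pi.mul_apply, prod_insert hi, hS, Function.update_self, sub_zero]
  ring

theorem shiftedWeight_map (e : κ ↪ ι) (T : Finset κ) (τ : κ → ℝ) (ρ : ι → ℝ) :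
    shiftedWeight x (T.map e) (Function.extend e τ ρ) w =
      shiftedWeight (fun i => x (e i)) T τ w := by
  funext ω
  simp only [shiftedWeight, prod_map, e.injective.extend_apply]

theorem shiftedWeight_disjSum (z : ι ⊕ κ → Ω → ℝ) (T : Finset κ) (τ : κ → ℝ) :
    shiftedWeight z (S.disjSum T) (Sum.elim σ τ) w =
      shiftedWeight (fun i => z (.inr i)) T τ (shiftedWeight (fun i => z (.inl i)) S σ w) := by
  funext ω
  simp only [shiftedWeight, prod_disjSum, Sum.elim_inl, Sum.elim_inr]
  ring

namespace SameMoments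

variable [Fintype Ω]

theorem symm (H : SameMoments x x' w w') : SameMoments x' x w' w :=
  fun S σ => (H S σ).symm

theorem sum_mul_eq {f f' : Ω → ℝ} (H : SameMoments x x' (w * f) (w' * f')) (S : Finset ι)
    (σ : ι → ℝ) :
    ∑ ω, (shiftedWeight x S σ w * f) ω = ∑ ω, (shiftedWeight x' S σ w' * f') ω := by
  simpa only [shiftedWeight_mul] using H S σ

theorem sum_mul_apply_eq (H : SameMoments x x' w w') {i : ι} (hi : i ∉ S) (σ : ι → ℝ) :
    ∑ ω, (shiftedWeight x S σ w * x i) ω = ∑ ω, (shiftedWeight x' S σ w' * x' i) ω := by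
  classical
  simpa only [shiftedWeight_insert hi] using H (insert i S) (Function.update σ i 0)

theorem comp (H : SameMoments x x' w w') (e : κ ↪ ι) :
    SameMoments (fun i => x (e i)) (fun i => x' (e i)) w w' := by
  intro T τ
  simpa only [shiftedWeight_map] using H (T.map e) (Function.extend e τ 0)

theorem comp_mul (H : SameMoments x x' w w') (e : κ ↪ ι) {j : ι} (hj : j ∉ Set.range e) :
    SameMoments (fun i => x (e i)) (fun i => x' (e i)) (w * x j) (w' * x' j) := by
  intro T τ
  have hjT : j ∉ T.map e := fun h => hj (by obtain ⟨i, -, hi⟩ := mem_map.1 h; exact ⟨i, hi⟩)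
  simpa only [shiftedWeight_map, shiftedWeight_mul] using
    H.sum_mul_apply_eq hjT (Function.extend e τ 0)

end SameMoments

end Moments

section Profiles

variable {K : ℕ} {k : Fin K} {α β : Profile K}

theorem unitProfile_le_iff : unitProfile k ≤ α ↔ α k = 1 := by
  have h1 : ∀ a : Fin 2, 1 ≤ a ↔ a = 1 := by decide
  simp only [unitProfile, Pi.single, update_le_iff, h1, Pi.zero_apply, Fin.zero_le, implies_true,
    and_true]

theorem le_iff_forall_eq_zero : β ≤ α ↔ ∀ k, α k = 0 → β k = 0 := by
  have h : ∀ a b : Fin 2, b ≤ a ↔ (a = 0 → b = 0) := by decide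
  exact forall_congr' fun k => h _ _

theorem exists_eq_one_of_ne_zero (hα : α ≠ 0) : ∃ k, α k = 1 :=
  (Function.ne_iff.1 hα).imp fun _ => Fin.eq_one_of_ne_zero _

theorem exists_ne_eq_one (hα : α ≠ 0) (hαk : α ≠ unitProfile k) : ∃ i ≠ k, α i = 1 := by
  contrapose! hαk
  have hk : α k = 1 := by
    obtain ⟨i, hi⟩ := exists_eq_one_of_ne_zero hα
    rwa [← of_not_not fun hik => hαk i hik hi]
  refine le_antisymm (le_iff_forall_eq_zero.2 fun i hi => ?_) (unitProfile_le_iff.2 hk)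
  refine of_not_not fun hαi => hαk i ?_ (Fin.eq_one_of_ne_zero _ hαi)
  rintro rfl
  simp [unitProfile] at hi

end Profiles

section UnitItems

variable {K : ℕ} {k : Fin K} {α β : Profile K}

/-- The behaviour of an item `f` whose `Q`-row is `e_k`: it is maximal exactly on the profiles that
possess `k`, and minimal at `𝟎`. The maximum is recorded as `f 1`. -/
structure IsUnitItem (k : Fin K) (f : Profile K → ℝ) : Prop where
  eq_top : ∀ α, α k = 1 → f α = f 1
  lt_top : ∀ α, α k = 0 → f α < f 1
  zero_le : ∀ α, f 0 ≤ f α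

namespace IsUnitItem

variable {f : Profile K → ℝ}

theorem ne_top (hf : IsUnitItem k f) (hα : α k = 0) : f α ≠ f 1 :=
  (hf.lt_top α hα).ne

theorem le_top (hf : IsUnitItem k f) (α : Profile K) : f α ≤ f 1 := by
  by_cases hα : α k = 0
  · exact (hf.lt_top α hα).le
  · exact (hf.eq_top α (Fin.eq_one_of_ne_zero _ hα)).le

end IsUnitItem

theorem IsItemParam.isUnitItem {J : ℕ} {Q : QMatrix J K} {Θ : ItemParam J K}
    (hΘ : IsItemParam Q Θ) {j : Fin J} (hj : Q j = unitProfile k) : IsUnitItem k (Θ j) where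
  eq_top α hα := hΘ.capable_eq j α 1 (hj ▸ unitProfile_le_iff.2 hα) (hj ▸ unitProfile_le_iff.2 rfl)
  lt_top α hα := hΘ.strict j k hj α fun h => by simp [unitProfile_le_iff.1 h] at hα
  zero_le := hΘ.zero_le j

variable {p p' u w w' : Profile K → ℝ}

theorem SameMoments.zero_lt_top {ι : Type*} {x x' : ι → Profile K → ℝ}
    (H : SameMoments x x' p p') (hp : ∀ α, 0 < p α) (hp' : ∀ α, 0 < p' α) {i : ι}
    (hx : IsUnitItem k (x i)) (hx' : IsUnitItem k (x' i)) : x i 0 < x' i 1 := by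
  by_contra! hle
  have hmean := H {i} fun i => x' i 1
  simp only [shiftedWeight, prod_singleton] at hmean
  refine hmean.not_gt (lt_of_le_of_lt (b := 0) ?_ ?_)
  · exact sum_nonpos fun α _ =>
      mul_nonpos_of_nonpos_of_nonneg (sub_nonpos.2 (hx'.le_top α)) (hp' α).le
  · refine sum_pos' (fun α _ => mul_nonneg ?_ (hp α).le) ⟨1, mem_univ _, mul_pos ?_ (hp 1)⟩
    · exact sub_nonneg.2 (hle.trans (hx.zero_le α))
    · exact sub_pos.2 (hle.trans_lt (hx.lt_top 0 rfl))

variable {x x' : Fin K → Profile K → ℝ}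

theorem shiftedWeight_top_eq_zero (hx : ∀ k, IsUnitItem k (x k)) (h : ¬ β ≤ α) :
    shiftedWeight x {k | α k = 0} (fun k => x k 1) w β = 0 := by
  simp only [le_iff_forall_eq_zero, not_forall] at h
  obtain ⟨k, hαk, hβk⟩ := h
  exact shiftedWeight_eq_zero_iff.2 <| .inl
    ⟨k, by simpa using hαk, (hx k).eq_top β (Fin.eq_one_of_ne_zero _ hβk)⟩

theorem shiftedWeight_top_ne_zero (hx : ∀ k, IsUnitItem k (x k)) (h : w α ≠ 0) :
    shiftedWeight x {k | α k = 0} (fun k => x k 1) w α ≠ 0 :=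
  shiftedWeight_ne_zero_iff.2 ⟨fun k hk => (hx k).ne_top (by simpa using hk), h⟩

theorem eq_zero_of_sum_shiftedWeight_top_eq_zero (hx : ∀ k, IsUnitItem k (x k))
    (hu : ∀ S, ∑ α, shiftedWeight x S (fun k => x k 1) u α = 0) (α : Profile K) : u α = 0 := by
  induction α using WellFoundedLT.induction with
  | ind α ih =>
    have hsum := hu {k | α k = 0}
    rw [Fintype.sum_eq_single α] at hsum
    · exact of_not_not fun h => shiftedWeight_top_ne_zero hx h hsum
    · intro β hβ
      by_cases hle : β ≤ α
      · exact shiftedWeight_eq_zero_iff.2 (.inr (ih β (hle.lt_of_ne hβ)))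
      · exact shiftedWeight_top_eq_zero hx hle

theorem SameMoments.weight_eq (H : SameMoments x x' w w') (hx' : ∀ k, IsUnitItem k (x' k))
    (hxx' : ∀ α, w α = 0 ∨ ∀ k, x k α = x' k α) : w = w' := by
  funext α
  refine sub_eq_zero.1 (eq_zero_of_sum_shiftedWeight_top_eq_zero (u := w - w') hx' ?_ α)
  intro S
  have hw : ∀ α, shiftedWeight x S (fun k => x' k 1) w α =
      shiftedWeight x' S (fun k => x' k 1) w α := by
    intro α
    rcases hxx' α with h | h <;> simp [shiftedWeight, h]
  have hS := H S fun k => x' k 1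
  simp only [hw] at hS
  simpa [shiftedWeight, mul_sub, sum_sub_distrib, sub_eq_zero] using hS

theorem shiftedWeight_top_eq_of_forall_lt (hx : ∀ k, IsUnitItem k (x k))
    (hx' : ∀ k, IsUnitItem k (x' k)) (htop : ∀ k, x k 1 = x' k 1)
    (hp : ∀ β < α, p β = p' β) (hxx' : ∀ β < α, ∀ k, x k β = x' k β) (hβ : β ≠ α) :
    shiftedWeight x {k | α k = 0} (fun k => x k 1) p β =
      shiftedWeight x' {k | α k = 0} (fun k => x k 1) p' β := by
  by_cases hle : β ≤ α
  · have hlt := hle.lt_of_ne hβ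
    simp only [shiftedWeight, hp β hlt, hxx' β hlt]
  · rw [shiftedWeight_top_eq_zero hx hle, funext htop, shiftedWeight_top_eq_zero hx' hle]

theorem SameMoments.apply_eq_of_forall_lt {f f' : Profile K → ℝ} (H : SameMoments x x' p p')
    (Hf : SameMoments x x' (p * f) (p' * f')) (hx : ∀ k, IsUnitItem k (x k))
    (hx' : ∀ k, IsUnitItem k (x' k)) (htop : ∀ k, x k 1 = x' k 1) (hpα : p α ≠ 0)
    (hp : ∀ β < α, p β = p' β) (hxx' : ∀ β < α, ∀ k, x k β = x' k β)
    (hf : ∀ β < α, f β = f' β) : f α = f' α := by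
  refine eq_of_sum_mul_eq_sum_mul (shiftedWeight_top_ne_zero hx hpα)
    (fun β hβ => shiftedWeight_top_eq_of_forall_lt hx hx' htop hp hxx' hβ) (fun β hβ => ?_)
    (H _ _) (Hf.sum_mul_eq _ _)
  by_cases hle : β ≤ α
  · exact .inr (hf β (hle.lt_of_ne hβ))
  · exact .inl (shiftedWeight_top_eq_zero hx hle)

theorem SameMoments.weight_apply_eq_of_forall_lt (H : SameMoments x x' p p')
    (hx : ∀ k, IsUnitItem k (x k)) (hx' : ∀ k, IsUnitItem k (x' k))
    (htop : ∀ k, x k 1 = x' k 1) (hp : ∀ β < α, p β = p' β)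
    (hxx' : ∀ β ≤ α, ∀ k, x k β = x' k β) : p α = p' α := by
  have hα := (sum_eq_sum_iff_single (mem_univ α) fun β _ hβ =>
    shiftedWeight_top_eq_of_forall_lt hx hx' htop hp (fun β hβ => hxx' β hβ.le) hβ).1 (H _ _)
  simp only [shiftedWeight, ← hxx' α le_rfl] at hα
  exact mul_left_cancel₀ (prod_ne_zero_iff.2 fun k hk =>
    sub_ne_zero.2 ((hx k).ne_top (by simpa using hk))) hα

end UnitItems

section TwoBlocks

variable {K : ℕ}

/-- Two blocks of `K` items, each of which has the identity as its `Q`-matrix. -/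
def HasTwoUnitBlocks (z : Fin K ⊕ Fin K → Profile K → ℝ) : Prop :=
  ∀ k, IsUnitItem k (z (.inl k)) ∧ IsUnitItem k (z (.inr k))

theorem HasTwoIdentities.hasTwoUnitBlocks {J : ℕ} {Q : QMatrix J K} {Θ : ItemParam J K}
    {rows : Fin K ⊕ Fin K ↪ Fin J} (hQ : HasTwoIdentities Q rows) (hΘ : IsItemParam Q Θ) :
    HasTwoUnitBlocks fun i => Θ (rows i) :=
  fun k => ⟨hΘ.isUnitItem (hQ k).1, hΘ.isUnitItem (hQ k).2⟩

variable {z z' : Fin K ⊕ Fin K → Profile K → ℝ} {p p' h h' : Profile K → ℝ}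

theorem HasTwoUnitBlocks.swap (hz : HasTwoUnitBlocks z) :
    HasTwoUnitBlocks fun i => z (Sum.swap i) :=
  fun k => (hz k).symm

theorem SameMoments.swap (H : SameMoments z z' p p') :
    SameMoments (fun i => z (Sum.swap i)) (fun i => z' (Sum.swap i)) p p' :=
  H.comp (Equiv.sumComm _ _).toEmbedding

theorem SameMoments.factor_zero_eq (H : SameMoments z z' p p')
    (Hh : SameMoments z z' (p * h) (p' * h')) (hz : HasTwoUnitBlocks z)
    (hz' : HasTwoUnitBlocks z') (hp : ∀ α, 0 < p α) (hp' : ∀ α, 0 < p' α) : h 0 = h' 0 := by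
  let σ : Fin K ⊕ Fin K → ℝ := Sum.elim (fun k => z (.inl k) 1) (fun k => z' (.inr k) 1)
  have hw : ∀ α ≠ 0, shiftedWeight z univ σ p α = 0 := fun α hα => by
    obtain ⟨k, hk⟩ := exists_eq_one_of_ne_zero hα
    exact shiftedWeight_eq_zero_iff.2 (.inl ⟨.inl k, mem_univ _, (hz k).1.eq_top α hk⟩)
  have hw' : ∀ α ≠ 0, shiftedWeight z' univ σ p' α = 0 := fun α hα => by
    obtain ⟨k, hk⟩ := exists_eq_one_of_ne_zero hα
    exact shiftedWeight_eq_zero_iff.2 (.inl ⟨.inr k, mem_univ _, (hz' k).2.eq_top α hk⟩)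
  have hw0 : shiftedWeight z univ σ p 0 ≠ 0 := by
    refine shiftedWeight_ne_zero_iff.2 ⟨?_, (hp 0).ne'⟩
    rintro (k | k) -
    · exact (hz k).1.ne_top rfl
    · exact (H.zero_lt_top hp hp' (hz k).2 (hz' k).2).ne
  exact eq_of_sum_mul_eq_sum_mul hw0 (fun α hα => (hw α hα).trans (hw' α hα).symm)
    (fun α hα => .inl (hw α hα)) (H univ σ) (Hh.sum_mul_eq univ σ)

theorem SameMoments.inr_zero_eq (H : SameMoments z z' p p')
    (Hh : SameMoments z z' (p * h) (p' * h')) (hz : HasTwoUnitBlocks z)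
    (hz' : HasTwoUnitBlocks z') (hp : ∀ α, 0 < p α) (hp' : ∀ α, 0 < p' α) {k : Fin K}
    (hk : h (unitProfile k) ≠ h 0) : z (.inr k) 0 = z' (.inr k) 0 := by
  -- The shift by `z' (.inl k) 1` lets the first model retain `e_k`, but not the second one.
  let σ : Fin K ⊕ Fin K → ℝ := Sum.elim (fun i => if i = k then z' (.inl k) 1 else z (.inl i) 1)
    (fun i => z' (.inr i) 1)
  let S : Finset (Fin K ⊕ Fin K) := univ.erase (.inr k)
  have hw : ∀ α, α ≠ 0 → α ≠ unitProfile k → shiftedWeight z S σ p α = 0 := fun α hα hαk => by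
    obtain ⟨i, hik, hi⟩ := exists_ne_eq_one hα hαk
    refine shiftedWeight_eq_zero_iff.2 (.inl ⟨.inl i, by simp [S], ?_⟩)
    simpa [σ, hik] using (hz i).1.eq_top α hi
  have hw' : ∀ α ≠ 0, shiftedWeight z' S σ p' α = 0 := fun α hα => by
    obtain ⟨i, hi⟩ := exists_eq_one_of_ne_zero hα
    rcases eq_or_ne i k with rfl | hik
    · exact shiftedWeight_eq_zero_iff.2
        (.inl ⟨.inl i, by simp [S], by simpa [σ] using (hz' i).1.eq_top α hi⟩)
    · exact shiftedWeight_eq_zero_iff.2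
        (.inl ⟨.inr i, by simp [S, hik], (hz' i).2.eq_top α hi⟩)
  have hw'0 : shiftedWeight z' S σ p' 0 ≠ 0 := by
    refine shiftedWeight_ne_zero_iff.2 ⟨?_, (hp' 0).ne'⟩
    rintro (i | i) -
    · by_cases hik : i = k
      · subst hik
        simpa [σ] using (hz' i).1.ne_top rfl
      · simpa [σ, hik] using (H.symm.zero_lt_top hp' hp (hz' i).1 (hz i).1).ne
    · exact (hz' i).2.ne_top rfl
  have hwk : shiftedWeight z S σ p (unitProfile k) = 0 :=
    eq_zero_of_sum_mul_eq_sum_mul hw hw' (H.factor_zero_eq Hh hz hz' hp hp') hk (H S σ)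
      (Hh.sum_mul_eq S σ)
  have hw0 : ∀ α ≠ 0, shiftedWeight z S σ p α = 0 := fun α hα => by
    rcases eq_or_ne α (unitProfile k) with rfl | hαk
    exacts [hwk, hw α hα hαk]
  exact (eq_of_sum_mul_eq_sum_mul hw'0 (fun α hα => (hw' α hα).trans (hw0 α hα).symm)
    (fun α hα => .inl (hw' α hα)) (H S σ).symm
    (H.sum_mul_apply_eq (notMem_erase _ _) σ).symm).symm

theorem SameMoments.zero_eq (H : SameMoments z z' p p') (hz : HasTwoUnitBlocks z)
    (hz' : HasTwoUnitBlocks z') (hp : ∀ α, 0 < p α) (hp' : ∀ α, 0 < p' α)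
    (hsep : ∀ k, ∃ h h' : Profile K → ℝ,
      SameMoments z z' (p * h) (p' * h') ∧ h (unitProfile k) ≠ h 0) :
    ∀ i, z i 0 = z' i 0 := by
  rintro (k | k) <;> obtain ⟨h, h', Hh, hk⟩ := hsep k
  · exact H.swap.inr_zero_eq Hh.swap hz.swap hz'.swap hp hp' hk
  · exact H.inr_zero_eq Hh hz hz' hp hp' hk

theorem SameMoments.exists_eq_inl_top (H : SameMoments z z' p p') (hz : HasTwoUnitBlocks z)
    (hz' : HasTwoUnitBlocks z') (hp' : ∀ α, p' α ≠ 0) (hzero : ∀ i, z i 0 = z' i 0)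
    {α : Profile K} (hα : α ≠ 0) : ∃ k, z' (.inl k) α = z (.inl k) 1 := by
  let σ : Fin K → ℝ := fun k => z (.inl k) 1
  have hw : ∀ β ≠ 0, shiftedWeight (fun k => z (.inl k)) univ σ p β = 0 := fun β hβ => by
    obtain ⟨k, hk⟩ := exists_eq_one_of_ne_zero hβ
    exact shiftedWeight_eq_zero_iff.2 (.inl ⟨k, mem_univ _, (hz k).1.eq_top β hk⟩)
  have H' : SameMoments (fun k => z (.inr k)) (fun k => z' (.inr k))
      (shiftedWeight (fun k => z (.inl k)) univ σ p)
      (shiftedWeight (fun k => z' (.inl k)) univ σ p') := fun T τ => by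
    simpa only [shiftedWeight_disjSum] using H (univ.disjSum T) (Sum.elim σ τ)
  have hww' := H'.weight_eq (fun k => (hz' k).2) fun β => by
    rcases eq_or_ne β 0 with rfl | hβ
    exacts [.inr fun k => hzero _, .inl (hw β hβ)]
  have hw'α := (congrFun hww' α).symm.trans (hw α hα)
  simpa [shiftedWeight_eq_zero_iff, hp' α] using hw'α

theorem SameMoments.inl_top_eq (H : SameMoments z z' p p') (hz : HasTwoUnitBlocks z)
    (hz' : HasTwoUnitBlocks z') (hp' : ∀ α, p' α ≠ 0) (hzero : ∀ i, z i 0 = z' i 0)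
    (k : Fin K) : z (.inl k) 1 = z' (.inl k) 1 := by
  by_contra hk
  -- No item `z' (.inl i)` attains `z (.inl i) 1` at the profile of attributes with differing tops.
  let α : Profile K := fun i => if z (.inl i) 1 = z' (.inl i) 1 then 0 else 1
  have hα : α ≠ 0 := fun h => by simpa [α, hk] using congrFun h k
  obtain ⟨i, hi⟩ := H.exists_eq_inl_top hz hz' hp' hzero hα
  by_cases htop : z (.inl i) 1 = z' (.inl i) 1
  · exact (hz' i).1.ne_top (by simp [α, htop]) (hi.trans htop)
  · exact htop (hi.symm.trans ((hz' i).1.eq_top α (by simp [α, htop])))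

theorem SameMoments.top_eq (H : SameMoments z z' p p') (hz : HasTwoUnitBlocks z)
    (hz' : HasTwoUnitBlocks z') (hp' : ∀ α, p' α ≠ 0) (hzero : ∀ i, z i 0 = z' i 0) :
    ∀ i, z i 1 = z' i 1 := by
  rintro (k | k)
  · exact H.inl_top_eq hz hz' hp' hzero k
  · exact H.swap.inl_top_eq hz.swap hz'.swap hp' (fun i => hzero i.swap) k

end TwoBlocks

section Model

theorem SameMoments.eq_of_top_eq {ι : Type*} {K : ℕ} {Θ Θ' : ι → Profile K → ℝ}
    {p p' : Profile K → ℝ} (H : SameMoments Θ Θ' p p') (hp : ∀ α, p α ≠ 0)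
    (rows : Fin K ⊕ Fin K ↪ ι) (hz : HasTwoUnitBlocks fun i => Θ (rows i))
    (hz' : HasTwoUnitBlocks fun i => Θ' (rows i)) (htop : ∀ i, Θ (rows i) 1 = Θ' (rows i) 1) :
    Θ = Θ' ∧ p = p' := by
  suffices h : ∀ α, (∀ j, Θ j α = Θ' j α) ∧ p α = p' α from
    ⟨funext₂ fun j α => (h α).1 j, funext fun α => (h α).2⟩
  intro α
  induction α using WellFoundedLT.induction with
  | ind α ih =>
    have hΘα : ∀ j, Θ j α = Θ' j α := by
      intro j
      by_cases hj : j ∈ Set.range (Function.Embedding.inl.trans rows)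
      · have hj' : j ∉ Set.range (Function.Embedding.inr.trans rows) := by
          obtain ⟨k, rfl⟩ := hj
          rintro ⟨l, hl⟩
          exact Sum.inr_ne_inl (rows.injective hl)
        exact (H.comp _).apply_eq_of_forall_lt (H.comp_mul _ hj') (fun k => (hz k).2)
          (fun k => (hz' k).2) (fun k => htop _) (hp α) (fun β hβ => (ih β hβ).2)
          (fun β hβ k => (ih β hβ).1 _) fun β hβ => (ih β hβ).1 j
      · exact (H.comp _).apply_eq_of_forall_lt (H.comp_mul _ hj) (fun k => (hz k).1)
          (fun k => (hz' k).1) (fun k => htop _) (hp α) (fun β hβ => (ih β hβ).2)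
          (fun β hβ k => (ih β hβ).1 _) fun β hβ => (ih β hβ).1 j
    refine ⟨hΘα, (H.comp (Function.Embedding.inl.trans rows)).weight_apply_eq_of_forall_lt
      (fun k => (hz k).1) (fun k => (hz' k).1) (fun k => htop _) (fun β hβ => (ih β hβ).2)
      fun β hβ k => ?_⟩
    rcases hβ.eq_or_lt with rfl | hβ
    exacts [hΘα _, (ih β hβ).1 _]

variable {J K : ℕ} {Θ Θ' : ItemParam J K} {p p' : Profile K → ℝ}

theorem sum_prod_mul_responseProb (c : Fin J → Fin 2 → ℝ) :
    ∑ r : Response J, (∏ j, c j (r j)) * responseProb Θ p r =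
      ∑ α, (∏ j, (c j 0 * (1 - Θ j α) + c j 1 * Θ j α)) * p α := by
  have hα : ∀ α, ∏ j, (c j 0 * (1 - Θ j α) + c j 1 * Θ j α) =
      ∑ r : Response J, ∏ j, c j (r j) * if r j = 1 then Θ j α else 1 - Θ j α := fun α => by
    rw [← Fintype.prod_sum fun j i => c j i * if i = 1 then Θ j α else 1 - Θ j α]
    simp [Fin.sum_univ_two]
  simp only [responseProb, condProb, hα, sum_mul, mul_sum, prod_mul_distrib, ← mul_assoc]
  exact sum_comm

theorem sameMoments_of_responseProb_eq
    (h : ∀ r, responseProb Θ p r = responseProb Θ' p' r) : SameMoments Θ Θ' p p' := by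
  intro S σ
  -- The coefficients turn the factor of item `j` into `θ_j - σ_j` if `j ∈ S`, and into `1` if not.
  let c : Fin J → Fin 2 → ℝ := fun j i => if j ∈ S then (i : ℝ) - σ j else 1
  have hc : ∀ (Θ : ItemParam J K) (α : Profile K),
      ∏ j, (c j 0 * (1 - Θ j α) + c j 1 * Θ j α) = ∏ j ∈ S, (Θ j α - σ j) := fun Θ α => by
    rw [← prod_ite_mem_eq S fun j => Θ j α - σ j]
    refine prod_congr rfl fun j _ => ?_
    by_cases hj : j ∈ S
    · simp only [c, hj, if_true, Fin.val_zero, Fin.val_one, Nat.cast_zero, Nat.cast_one]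
      ring
    · simp [c, hj]
  have hsum := sum_prod_mul_responseProb (Θ := Θ) (p := p) c
  simp only [h, sum_prod_mul_responseProb, hc] at hsum
  exact hsum.symm

end Model

end RestrictedLCM

open RestrictedLCM in
theorem theorem1_general {J K : ℕ} {Θ Θ' : ItemParam J K} {p p' : Profile K → ℝ}
    (hp : ∀ α, 0 < p α) (hp' : ∀ α, 0 < p' α) {rows : Fin K ⊕ Fin K ↪ Fin J}
    (hz : HasTwoUnitBlocks fun i => Θ (rows i)) (hz' : HasTwoUnitBlocks fun i => Θ' (rows i))
    (hsep : Separates Θ rows) :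
    (∀ r, responseProb Θ p r = responseProb Θ' p' r) ↔ Θ = Θ' ∧ p = p' := by
  constructor
  · intro h
    have H := sameMoments_of_responseProb_eq h
    have hzero : ∀ i, Θ (rows i) 0 = Θ' (rows i) 0 :=
      (H.comp rows).zero_eq hz hz' hp hp' fun k => by
        obtain ⟨j, hj, hjk⟩ := hsep k
        exact ⟨Θ j, Θ' j, H.comp_mul rows hj, hjk⟩
    have htop : ∀ i, Θ (rows i) 1 = Θ' (rows i) 1 :=
      (H.comp rows).top_eq hz hz' (fun α => (hp' α).ne') hzero
    exact H.eq_of_top_eq (fun α => (hp α).ne') rows hz hz' htop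
  · rintro ⟨rfl, rfl⟩ r
    rfl

theorem theorem1 {J K : ℕ} (Q : RestrictedLCM.QMatrix J K)
    (Θ : RestrictedLCM.ItemParam J K) (p : RestrictedLCM.Profile K → ℝ)
    (hΘ : RestrictedLCM.IsItemParam Q Θ) (hp : RestrictedLCM.IsProportion p)
    (rows : Fin K ⊕ Fin K ↪ Fin J)
    (hC1 : RestrictedLCM.HasTwoIdentities Q rows)
    (hC2 : RestrictedLCM.Separates Θ rows) :
    RestrictedLCM.Identifiable Q Θ p := fun _ _ hΘ' hp' =>
  theorem1_general (fun α => (hp.mem_Ioo α).1) (fun α => (hp'.mem_Ioo α).1)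
    (hC1.hasTwoUnitBlocks hΘ) (hC1.hasTwoUnitBlocks hΘ') hC2
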